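/- All quantum states are pure and normalized, and preparation is exact. For $k \in \mathbb{N}$, consider circuits whose gates are arbitrary single-qubit unitaries, Toffoli gates with any number of controls, and the gate $\mathrm{FANOUT}_k$ given by $|b\rangle|x\rangle \mapsto |b\rangle|x \oplus b^k\rangle$ for $b \in \{0,1\}$, $x \in \{0,1\}^k$. The gates are arranged in layers, the gates of one layer act on pairwise disjoint sets of qubits, and the depth is the number of layers. A circuit $C$ cleanly prepares an $r$-qubit state $|\psi\rangle$ with $m$ ancillae if $C|0^r\rangle|0^m\rangle = |\psi\rangle|0^m\rangle$. Preparation in $\mathsf{QAC}^0_f$ (with parameter $n$) means clean preparation by circuits with $\mathrm{FANOUT}_n$ gates, of depth bounded by a constant and with $\mathrm{poly}(n)$ ancillae. (1) Any $O(\log n)$-qubit state can be cleanly prepared in $\mathsf{QAC}^0_f$ using $\mathrm{poly}(n)$ ancillae: for every real $K$ there are $d, a, n_0 \in \mathbb{N}$ such that for all $n \ge n_0$, all $\ell \in \mathbb{N}$ with $\ell \le K \log n$ and every $\ell$-qubit state $|\psi\rangle$, some circuit of depth at most $d$ with $\mathrm{FANOUT}_n$ gates cleanly prepares $|\psi\rangle$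 with at most $n^a$ ancillae. (2) Any superposition of the one-hot basis states can be cleanly prepared in $\mathsf{QAC}^0_f$: there are $d, a, n_0 \in \mathbb{N}$ such that for all $n \ge n_0$ and all $c_1, \dots, c_n \in \mathbb{C}$ with $\sum_{i=1}^n |c_i|^2 = 1$, some circuit of depth at most $d$ with $\mathrm{FANOUT}_n$ gates cleanly prepares the $n$-qubit state $\sum_{i=1}^n c_i |e_i\rangle$ with at most $n^a$ ancillae, where $e_i \in \{0,1\}^n$ is the string whose only $1$ is in position $i$. -/

import Mathlib

noncomputable section

namespace QAC

/-- Vectors of the Hilbert space of the qubits indexed by `Q`, given by their amplitudes in the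
standard basis `|x⟩`, `x : Q → Bool`. -/
abbrev Vec (Q : Type) : Type := (Q → Bool) → ℂ

/-- A (pure, normalized) state. -/
def IsState {Q : Type} [Fintype Q] [DecidableEq Q] (ψ : Vec Q) : Prop :=
  ∑ x : Q → Bool, ‖ψ x‖ ^ 2 = 1

/-- The standard basis vector `|y⟩`. -/
def ket {Q : Type} [Fintype Q] (y : Q → Bool) : Vec Q :=
  fun x => if x = y then 1 else 0

/-- The one-hot string `e_i`: bit `i` is one and all other bits are zero. -/
def oneHot {n : ℕ} (i : Fin n) : Fin n → Bool :=
  fun j => decide (j = i)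

/-- The gates available on the qubits `Q`: arbitrary single-qubit unitaries, Toffoli gates with any
number of controls, and `FANOUT_k` gates, which have exactly `k` targets. -/
inductive Gate (Q : Type) (k : ℕ) : Type
  | single (q : Q) (U : Matrix.unitaryGroup Bool ℂ) : Gate Q k
  | toffoli (controls : Finset Q) (target : Q) (h : target ∉ controls) : Gate Q k
  | fanout (source : Q) (targets : Finset Q) (h : source ∉ targets) (hk : targets.card = k) :
      Gate Q k

namespace Gate

variable {Q : Type} [DecidableEq Q] {k : ℕ}

/-- The qubits a gate acts on. -/
def support : Gate Q k → Finset Q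
  | single q _ => {q}
  | toffoli controls target _ => insert target controls
  | fanout source targets _ _ => insert source targets

/-- The action of a gate on vectors. The Toffoli gate sends `|x⟩` to `|x⟩` with the target flipped
if all controls are one; the fanout gate sends `|b⟩|y⟩` to `|b⟩|y ⊕ b^k⟩`. Both are
involutive permutations of the standard basis, so that the amplitude of the image at `x` is the
amplitude of the given vector at the image of `x`. -/
def apply : Gate Q k → Vec Q → Vec Q
  | single q U, ψ => fun x => ∑ b : Bool, U.1 (x q) b * ψ (Function.update x q b)
  | toffoli controls target _, ψ => fun x =>
      ψ (if ∀ c ∈ controls, x c = true then Function.update x target (!(x target)) else x)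
  | fanout source targets _ _, ψ => fun x =>
      ψ (fun q => if q ∈ targets then xor (x q) (x source) else x q)

end Gate

/-- A layer: gates acting on pairwise disjoint sets of qubits. -/
structure Layer (Q : Type) [DecidableEq Q] (k : ℕ) : Type where
  gates : List (Gate Q k)
  disjoint : gates.Pairwise fun g g' => Disjoint g.support g'.support

/-- The action of a layer; the gates of a layer commute, so their order is immaterial. -/
def Layer.apply {Q : Type} [DecidableEq Q] {k : ℕ} (L : Layer Q k) (ψ : Vec Q) : Vec Q :=
  L.gates.foldl (fun φ g => g.apply φ) ψ

/-- A circuit: a sequence of layers, the first of which is applied first. -/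
abbrev Circuit (Q : Type) [DecidableEq Q] (k : ℕ) : Type := List (Layer Q k)

namespace Circuit

variable {Q : Type} [DecidableEq Q] {k : ℕ}

/-- The action of a circuit. -/
def apply (C : Circuit Q k) (ψ : Vec Q) : Vec Q :=
  C.foldl (fun φ L => L.apply φ) ψ

/-- The number of layers, those of single-qubit gates included. -/
def depth (C : Circuit Q k) : ℕ := C.length

end Circuit

/-- The vector `|ψ⟩|0^m⟩`. -/
def withZeros {n : ℕ} (m : ℕ) (ψ : Vec (Fin n)) : Vec (Fin n ⊕ Fin m) :=
  fun x => if ∀ j : Fin m, x (Sum.inr j) = false then ψ (fun i => x (Sum.inl i)) else 0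

/-- `C` cleanly prepares `|ψ⟩` with `m` ancillae: `C |0^n⟩|0^m⟩ = |ψ⟩|0^m⟩`. -/
def CleanlyPrepares {n m k : ℕ} (C : Circuit (Fin n ⊕ Fin m) k) (ψ : Vec (Fin n)) : Prop :=
  C.apply (ket fun _ => false) = withZeros m ψ

/-- `|ψ⟩` is cleanly prepared by a circuit of Toffoli gates, single-qubit unitaries and `FANOUT_k`
gates with at most `d` layers and at most `s` ancillae. -/
def CleanlyPreparable (k d s : ℕ) {n : ℕ} (ψ : Vec (Fin n)) : Prop :=
  ∃ m ≤ s, ∃ C : Circuit (Fin n ⊕ Fin m) k, C.depth ≤ d ∧ CleanlyPrepares C ψ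

end QAC

end

/-! Everything rests on exact amplitude amplification. With `a i = (1 + t² ‖c i‖²)^(-1/2)`, put
qubit `i` in the state `a i (|0⟩ - t c i |1⟩)`. In the product state the amplitude of the `i`-th
one-hot string is `-c i` times `t ∏ a j`, and `t` can be chosen to make that factor `1/2`
(`exists_mul_prod_inv_sqrt_eq_half`). The one-hot part then has squared norm `1/4`, i.e. angle 30°,
so a single Grover step rotates it to exactly 90° and leaves the desired superposition with no error
(`exists_amplification_circuit`, `exists_oneHot_circuit`).

The two reflections have constant depth. A tree of fanout gates with `K` levels makes `(n + 1) ^ K`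
copies of a register (`exists_copy_circuit`), so all one-hot strings can be tested in parallel, each
on its own copy by one Toffoli gate. A `Z` on the results gives the phase, and the reversed
computation cleans up (`exists_phase_circuit`).

For an arbitrary state on `l` qubits with `2 ^ l ≤ (n + 1) ^ K`, first prepare its one-hot encoding,
indexed by all `l`-bit strings. Then compute the binary string from the one-hot register
(`exists_write_binary_circuit`) and erase the one-hot register using the binary one
(`exists_erase_oneHot_circuit`). Both are classical reversible circuits of constant depth for fixed
`K`. -/

noncomputable section

namespace QAC

/-! ### Toffoli and fanout circuits as permutations of bit strings -/

section Classical

variable {Q : Type} [DecidableEq Q] {k : ℕ}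

/-- The action of a Toffoli or fanout gate on bit strings. -/
def Gate.perm : Gate Q k → (Q → Bool) → Q → Bool
  | single _ _, x => x
  | toffoli controls target _, x =>
      if ∀ c ∈ controls, x c = true then Function.update x target (!(x target)) else x
  | fanout source targets _ _, x =>
      fun q => if q ∈ targets then xor (x q) (x source) else x q

/-- A gate is classical if it permutes the standard basis according to `Gate.perm`. -/
def Gate.IsClassical (g : Gate Q k) : Prop := ∀ ψ, g.apply ψ = ψ ∘ g.perm

lemma Gate.isClassical_toffoli (c : Finset Q) (t : Q) (h : t ∉ c) :
    (Gate.toffoli c t h : Gate Q k).IsClassical := fun _ => rfl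

lemma Gate.isClassical_fanout (s : Q) (t : Finset Q) (h : s ∉ t) (hk : t.card = k) :
    (Gate.fanout s t h hk).IsClassical := fun _ => rfl

lemma Gate.perm_perm (g : Gate Q k) (x : Q → Bool) : g.perm (g.perm x) = x := by
  cases g with
  | single q U => rfl
  | toffoli c t h =>
    by_cases hx : ∀ a ∈ c, x a = true
    · have hx' : ∀ a ∈ c, Function.update x t (!x t) a = true := fun a ha => by
        rw [Function.update_of_ne (by rintro rfl; exact h ha)]; exact hx a ha
      simp only [perm, if_pos hx, if_pos hx']
      ext q
      by_cases hq : q = t <;> simp [hq]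
    · simp only [perm, if_neg hx]
  | fanout s t h hk =>
    ext q
    by_cases hq : q ∈ t <;> simp [perm, hq, h]

lemma Gate.perm_of_notMem (g : Gate Q k) (x : Q → Bool) {q : Q} (hq : q ∉ g.support) :
    g.perm x q = x q := by
  cases g with
  | single q U => rfl
  | toffoli c t h =>
    simp only [support, Finset.mem_insert, not_or] at hq
    simp only [perm]
    split_ifs
    · exact Function.update_of_ne hq.1 _ _
    · rfl
  | fanout s t h hk =>
    simp only [support, Finset.mem_insert, not_or] at hq
    simp [perm, hq.2]

lemma Gate.perm_congr (g : Gate Q k) {x y : Q → Bool} (h : ∀ q ∈ g.support, x q = y q) {q : Q}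
    (hq : q ∈ g.support) : g.perm x q = g.perm y q := by
  cases g with
  | single q U => exact h _ hq
  | toffoli c t ht =>
    simp only [support, Finset.mem_insert, forall_eq_or_imp] at h
    have hc : (∀ a ∈ c, x a = true) ↔ ∀ a ∈ c, y a = true :=
      forall₂_congr fun a ha => by rw [h.2 a ha]
    simp only [support, Finset.mem_insert] at hq
    simp only [perm, hc]
    have hxy : x q = y q := by
      rcases hq with rfl | hq
      exacts [h.1, h.2 _ hq]
    split_ifs
    · by_cases hqt : q = t
      · subst hqt; simp [hxy]
      · simpa [hqt] using hxy
    · exact hxy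
  | fanout s t hs hk =>
    simp only [perm]
    rw [h q hq, h s (by simp [support])]

/-- The action of a layer of Toffoli and fanout gates on bit strings. -/
def Layer.perm (L : Layer Q k) (x : Q → Bool) : Q → Bool :=
  L.gates.foldl (fun y g => g.perm y) x

/-- A layer is classical if all its gates are. -/
def Layer.IsClassical (L : Layer Q k) : Prop := ∀ g ∈ L.gates, g.IsClassical

lemma foldl_perm_of_forall_notMem (l : List (Gate Q k)) (x : Q → Bool) {q : Q}
    (h : ∀ g ∈ l, q ∉ g.support) : l.foldl (fun y g => g.perm y) x q = x q := by
  induction l generalizing x with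
  | nil => rfl
  | cons g l ih =>
    rw [List.foldl_cons, ih _ fun g' hg' => h g' (List.mem_cons_of_mem _ hg'),
      g.perm_of_notMem _ (h g List.mem_cons_self)]

/-- The other gates of the layer never touch the support of `g`, and `g` reads nothing outside it.
So on that support only `g` matters, whatever the order of the list. -/
lemma foldl_perm_of_mem (l : List (Gate Q k))
    (hl : l.Pairwise fun g g' => Disjoint g.support g'.support) (x : Q → Bool) {g : Gate Q k}
    (hg : g ∈ l) {q : Q} (hq : q ∈ g.support) :
    l.foldl (fun y g => g.perm y) x q = g.perm x q := by
  induction l generalizing x with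
  | nil => simp at hg
  | cons g' l ih =>
    rw [List.pairwise_cons] at hl
    rw [List.foldl_cons]
    rcases List.mem_cons.1 hg with rfl | hg
    · exact foldl_perm_of_forall_notMem _ _ fun g' hg' =>
        Finset.disjoint_left.1 (hl.1 g' hg') hq
    · rw [ih hl.2 _ hg]
      exact g.perm_congr (fun p hp => g'.perm_of_notMem _
        (Finset.disjoint_right.1 (hl.1 g hg) hp)) hq

lemma Layer.perm_of_mem (L : Layer Q k) (x : Q → Bool) {g : Gate Q k} (hg : g ∈ L.gates) {q : Q}
    (hq : q ∈ g.support) : L.perm x q = g.perm x q :=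
  foldl_perm_of_mem _ L.disjoint x hg hq

lemma Layer.perm_of_forall_notMem (L : Layer Q k) (x : Q → Bool) {q : Q}
    (h : ∀ g ∈ L.gates, q ∉ g.support) : L.perm x q = x q :=
  foldl_perm_of_forall_notMem _ _ h

/-- Locally a layer is one of its gates, and each gate is an involution. This is what makes the
reversed circuit an inverse. -/
lemma Layer.perm_perm (L : Layer Q k) (x : Q → Bool) : L.perm (L.perm x) = x := by
  ext q
  by_cases h : ∃ g ∈ L.gates, q ∈ g.support
  · obtain ⟨g, hg, hq⟩ := h
    rw [L.perm_of_mem _ hg hq, g.perm_congr (fun p hp => L.perm_of_mem x hg hp) hq, g.perm_perm]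
  · push Not at h
    rw [L.perm_of_forall_notMem _ h, L.perm_of_forall_notMem _ h]

namespace Circuit

/-- The action of a circuit of Toffoli and fanout gates on bit strings. -/
def perm (C : Circuit Q k) (x : Q → Bool) : Q → Bool :=
  C.foldl (fun y L => L.perm y) x

/-- A circuit is classical if all its gates are. -/
def IsClassical (C : Circuit Q k) : Prop := ∀ L ∈ C, L.IsClassical

@[simp] lemma perm_nil (x : Q → Bool) : perm ([] : Circuit Q k) x = x := rfl

@[simp] lemma perm_cons (L : Layer Q k) (C : Circuit Q k) (x : Q → Bool) :
    perm (L :: C) x = perm C (L.perm x) := rfl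

@[simp] lemma perm_append (C C' : Circuit Q k) (x : Q → Bool) :
    perm (C ++ C') x = perm C' (perm C x) := List.foldl_append ..

lemma perm_reverse_perm (C : Circuit Q k) (x : Q → Bool) : perm C.reverse (perm C x) = x := by
  induction C generalizing x with
  | nil => rfl
  | cons L C ih =>
    rw [List.reverse_cons, perm_append, perm_cons L C, ih, perm_cons, perm_nil, L.perm_perm]

lemma IsClassical.append {C C' : Circuit Q k} (h : IsClassical C) (h' : IsClassical C') :
    IsClassical (C ++ C') := fun L hL => (List.mem_append.1 hL).elim (h L) (h' L)

lemma IsClassical.reverse {C : Circuit Q k} (h : IsClassical C) : IsClassical C.reverse :=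
  fun L hL => h L (List.mem_reverse.1 hL)

lemma isClassical_nil : IsClassical ([] : Circuit Q k) := fun _ h => by simp at h

lemma IsClassical.cons {L : Layer Q k} {C : Circuit Q k} (hL : L.IsClassical)
    (h : IsClassical C) : IsClassical (L :: C) := fun L' h' => by
  rcases List.mem_cons.1 h' with rfl | h'
  exacts [hL, h _ h']

lemma apply_append (C C' : Circuit Q k) (ψ : Vec Q) :
    apply (C ++ C') ψ = apply C' (apply C ψ) := List.foldl_append ..

lemma apply_cons (L : Layer Q k) (C : Circuit Q k) (ψ : Vec Q) :
    apply (L :: C) ψ = apply C (L.apply ψ) := rfl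

lemma apply_nil (ψ : Vec Q) : apply ([] : Circuit Q k) ψ = ψ := rfl

end Circuit

/-- The layer consisting of a finite family of gates with disjoint supports. -/
def Layer.ofFamily {ι : Type} [Fintype ι] (g : ι → Gate Q k)
    (h : Pairwise fun i j => Disjoint (g i).support (g j).support) : Layer Q k where
  gates := Finset.univ.toList.map g
  disjoint := by
    rw [List.pairwise_map]
    exact (Finset.nodup_toList _).imp fun hij => h hij

lemma Layer.mem_ofFamily {ι : Type} [Fintype ι] {g : ι → Gate Q k}
    {h : Pairwise fun i j => Disjoint (g i).support (g j).support} {g' : Gate Q k} :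
    g' ∈ (Layer.ofFamily g h).gates ↔ ∃ i, g i = g' := by
  simp [Layer.ofFamily]

/-- Toffoli gates on disjoint sets of qubits can be applied in one layer. -/
lemma exists_toffoli_layer {ι : Type} [Fintype ι] (k : ℕ) (c : ι → Finset Q) (t : ι → Q)
    (ht : ∀ i, t i ∉ c i)
    (h : Pairwise fun i j => Disjoint (insert (t i) (c i)) (insert (t j) (c j))) :
    ∃ L : Layer Q k, L.IsClassical ∧
      (∀ x i, L.perm x (t i) = xor (x (t i)) (decide (∀ q ∈ c i, x q = true))) ∧
      ∀ x q, (∀ i, q ≠ t i) → L.perm x q = x q := by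
  let g : ι → Gate Q k := fun i => Gate.toffoli (c i) (t i) (ht i)
  have hg : Pairwise fun i j => Disjoint (g i).support (g j).support := h
  have hmem : ∀ i, g i ∈ (Layer.ofFamily g hg).gates := fun i => Layer.mem_ofFamily.2 ⟨i, rfl⟩
  refine ⟨Layer.ofFamily g hg, ?_, ?_, ?_⟩
  · intro g' hg'
    obtain ⟨i, rfl⟩ := Layer.mem_ofFamily.1 hg'
    exact Gate.isClassical_toffoli (c i) (t i) (ht i)
  · intro x i
    rw [Layer.perm_of_mem _ x (hmem i) (Finset.mem_insert_self (t i) (c i))]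
    by_cases hx : ∀ q ∈ c i, x q = true
    · simp only [g, Gate.perm, if_pos hx, Function.update_self, decide_eq_true hx, Bool.xor_true]
    · simp only [g, Gate.perm, if_neg hx, decide_eq_false hx, Bool.xor_false]
  · intro x q hq
    by_cases hm : ∃ i, q ∈ insert (t i) (c i)
    · obtain ⟨i, hi⟩ := hm
      rw [Layer.perm_of_mem _ x (hmem i) hi]
      simp only [g, Gate.perm]
      split_ifs
      · exact Function.update_of_ne (hq i) _ _
      · rfl
    · push Not at hm
      refine Layer.perm_of_forall_notMem _ _ fun g' hg' => ?_
      obtain ⟨i, rfl⟩ := Layer.mem_ofFamily.1 hg'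
      exact hm i

/-- Any set of qubits can be negated in one layer. -/
lemma exists_not_layer [Fintype Q] (k : ℕ) (S : Finset Q) :
    ∃ L : Layer Q k, L.IsClassical ∧ ∀ x q, L.perm x q = xor (x q) (decide (q ∈ S)) := by
  -- A Toffoli gate without controls is a NOT gate.
  obtain ⟨L, hL, h1, h2⟩ := exists_toffoli_layer (ι := S) k (fun _ => ∅) (fun q => q.1)
    (by simp) (fun i j hij => by simpa using fun e => hij (Subtype.ext e))
  refine ⟨L, hL, fun x q => ?_⟩
  by_cases hq : q ∈ S
  · simpa [hq] using h1 x ⟨q, hq⟩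
  · rw [h2 x q fun i e => hq (e ▸ i.2)]
    simp [hq]

end Classical

/-! ### Linearity, and the action on basis vectors -/

section Linear

lemma isLinearMap_foldl {Q α : Type} {f : Vec Q → α → Vec Q} (l : List α)
    (h : ∀ a, IsLinearMap ℂ fun ψ => f ψ a) : IsLinearMap ℂ fun ψ => l.foldl f ψ := by
  induction l with
  | nil => exact ⟨fun _ _ => rfl, fun _ _ => rfl⟩
  | cons a l ih =>
    exact ⟨fun ψ φ => by simp only [List.foldl_cons, (h a).map_add, ih.map_add],
      fun c ψ => by simp only [List.foldl_cons, (h a).map_smul, ih.map_smul]⟩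

lemma Gate.isLinearMap_apply {Q : Type} [DecidableEq Q] {k : ℕ} (g : Gate Q k) :
    IsLinearMap ℂ g.apply := by
  cases g with
  | single q U =>
    constructor
    · intro ψ φ; ext x
      simp only [apply, Pi.add_apply, mul_add, Finset.sum_add_distrib]
    · intro a ψ; ext x
      simp only [apply, Pi.smul_apply, smul_eq_mul, Finset.mul_sum]
      exact Finset.sum_congr rfl fun b _ => by ring
  | toffoli => exact ⟨fun _ _ => rfl, fun _ _ => rfl⟩
  | fanout => exact ⟨fun _ _ => rfl, fun _ _ => rfl⟩

lemma Layer.isLinearMap_apply {Q : Type} [DecidableEq Q] {k : ℕ} (L : Layer Q k) :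
    IsLinearMap ℂ L.apply :=
  isLinearMap_foldl _ fun g => g.isLinearMap_apply

lemma Circuit.isLinearMap_apply {Q : Type} [DecidableEq Q] {k : ℕ} (C : Circuit Q k) :
    IsLinearMap ℂ C.apply :=
  isLinearMap_foldl _ fun L => L.isLinearMap_apply

lemma _root_.IsLinearMap.map_sum_smul {Q : Type} {ι : Type*} {f : Vec Q → Vec Q}
    (hf : IsLinearMap ℂ f) (s : Finset ι) (a : ι → ℂ) (v : ι → Vec Q) :
    f (∑ i ∈ s, a i • v i) = ∑ i ∈ s, a i • f (v i) := by
  exact (map_sum (hf.mk' f) (fun i => a i • v i) s).trans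
    (Finset.sum_congr rfl fun i _ => hf.map_smul (a i) (v i))

variable {Q : Type} [Fintype Q] [DecidableEq Q] {k : ℕ}

lemma eq_sum_smul_ket (ψ : Vec Q) : ψ = ∑ x, ψ x • ket x := by
  ext y
  simp [ket]

lemma Gate.IsClassical.apply_ket {g : Gate Q k} (hg : g.IsClassical) (x : Q → Bool) :
    g.apply (ket x) = ket (g.perm x) := by
  rw [hg]
  ext y
  have : g.perm y = x ↔ y = g.perm x :=
    ⟨fun h => by rw [← h, g.perm_perm], fun h => by rw [h, g.perm_perm]⟩
  simp [ket, this]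

lemma Layer.IsClassical.apply_ket {L : Layer Q k} (hL : L.IsClassical) (x : Q → Bool) :
    L.apply (ket x) = ket (L.perm x) := by
  have aux : ∀ (l : List (Gate Q k)), (∀ g ∈ l, g.IsClassical) → ∀ x : Q → Bool,
      l.foldl (fun φ g => g.apply φ) (ket x) = ket (l.foldl (fun y g => g.perm y) x) := by
    intro l
    induction l with
    | nil => intros; rfl
    | cons g l ih =>
      intro h x
      rw [List.foldl_cons, (h g List.mem_cons_self).apply_ket,
        ih fun g' hg' => h g' (List.mem_cons_of_mem _ hg')]
      rfl
  exact aux _ hL x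

lemma Circuit.IsClassical.apply_ket {C : Circuit Q k} (hC : IsClassical C) (x : Q → Bool) :
    C.apply (ket x) = ket (C.perm x) := by
  induction C generalizing x with
  | nil => rfl
  | cons L C ih =>
    rw [apply_cons, (hC L List.mem_cons_self).apply_ket,
      ih fun L' h' => hC L' (List.mem_cons_of_mem _ h')]
    rfl

end Linear

/-! ### Layers of single-qubit unitaries, and phase oracles -/

section Product

variable {Q : Type} [Fintype Q] [DecidableEq Q] {k : ℕ}

/-- The layer applying the single-qubit unitary `U q` to each qubit `q`. -/
def Layer.product (k : ℕ) (U : Q → Matrix.unitaryGroup Bool ℂ) : Layer Q k :=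
  Layer.ofFamily (fun q => Gate.single q (U q)) fun p q hpq => by simpa [Gate.support] using hpq

lemma Gate.single_apply {Q : Type} [DecidableEq Q] {k : ℕ} (q : Q)
    (U : Matrix.unitaryGroup Bool ℂ) (ψ : Vec Q) (x : Q → Bool) :
    (Gate.single q U : Gate Q k).apply ψ x = ∑ b, U.1 (x q) b * ψ (Function.update x q b) := rfl

lemma Layer.product_apply_ket (U : Q → Matrix.unitaryGroup Bool ℂ) (z x : Q → Bool) :
    (Layer.product k U).apply (ket z) x = ∏ q, (U q).1 (x q) (z q) := by
  -- Generalized to a partial layer: a qubit not yet acted on contributes a Kronecker delta. The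
  -- list grows at its end because `foldl` applies its last gate last.
  have aux : ∀ l : List Q, l.Nodup → ∀ x,
      (l.map fun q => (Gate.single q (U q) : Gate Q k)).foldl (fun φ g => g.apply φ) (ket z) x =
        ∏ q, if q ∈ l then (U q).1 (x q) (z q) else if x q = z q then 1 else 0 := by
    intro l
    induction l using List.reverseRecOn with
    | nil => intro _ x; simp [ket, Fintype.prod_ite_zero, funext_iff]
    | append_singleton l p ih =>
      intro hl x
      rw [List.nodup_append] at hl
      have hp : p ∉ l := fun h => hl.2.2 p h p (by simp) rfl
      rw [List.map_append, List.foldl_append]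
      simp only [List.map_cons, List.map_nil, List.foldl_cons, List.foldl_nil, Gate.single_apply,
        ih hl.1]
      rw [← Finset.mul_prod_erase _ _ (Finset.mem_univ p)]
      have h1 : ∀ b, (∏ q, if q ∈ l then (U q).1 (Function.update x p b q) (z q) else
          if Function.update x p b q = z q then 1 else 0) = (if b = z p then 1 else 0) *
          ∏ q ∈ Finset.univ.erase p, if q ∈ l ++ [p] then (U q).1 (x q) (z q) else
            if x q = z q then 1 else 0 := by
        intro b
        rw [← Finset.mul_prod_erase _ _ (Finset.mem_univ p)]
        congr 1
        · simp [hp]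
        · refine Finset.prod_congr rfl fun q hq => ?_
          have hqp : q ≠ p := Finset.ne_of_mem_erase hq
          simp [hqp]
      simp only [h1]
      simp
  have := aux Finset.univ.toList (Finset.nodup_toList _) x
  simp only [Finset.mem_toList, Finset.mem_univ, if_true] at this
  exact this

lemma Layer.product_apply (U : Q → Matrix.unitaryGroup Bool ℂ) (ψ : Vec Q) (x : Q → Bool) :
    (Layer.product k U).apply ψ x = ∑ z, ψ z * ∏ q, (U q).1 (x q) (z q) := by
  conv_lhs => rw [eq_sum_smul_ket ψ, (Layer.isLinearMap_apply _).map_sum_smul]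
  simp [Layer.product_apply_ket]

/-- The sum over intermediate strings of a product over qubits factors into one matrix product per
qubit. -/
lemma Layer.product_product_apply (U V : Q → Matrix.unitaryGroup Bool ℂ) (h : ∀ q, U q * V q = 1)
    (ψ : Vec Q) : (Layer.product k U).apply ((Layer.product k V).apply ψ) = ψ := by
  ext x
  simp only [Layer.product_apply, Finset.sum_mul]
  rw [Finset.sum_comm]
  have h1 : ∀ z : Q → Bool, ∑ y : Q → Bool,
      ψ z * (∏ q, (V q).1 (y q) (z q)) * ∏ q, (U q).1 (x q) (y q) =
        ψ z * if x = z then 1 else 0 := by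
    intro z
    simp only [mul_assoc, ← Finset.prod_mul_distrib, ← Finset.mul_sum]
    congr 1
    have h2 : ∀ q, ∑ b, (V q).1 b (z q) * (U q).1 (x q) b = if x q = z q then 1 else 0 := by
      intro q
      have := congrFun (congrFun (congrArg Subtype.val (h q)) (x q)) (z q)
      simp only [Submonoid.coe_mul, Matrix.mul_apply, OneMemClass.coe_one, Matrix.one_apply] at this
      rw [← this]
      exact Finset.sum_congr rfl fun _ _ => mul_comm _ _
    rw [← Fintype.prod_sum (fun q b => (V q).1 b (z q) * (U q).1 (x q) b)]
    simp only [h2, Fintype.prod_ite_zero, funext_iff, Finset.prod_const_one]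
  simp [h1]

/-- The Pauli matrix `Z`. -/
def pauliZ : Matrix.unitaryGroup Bool ℂ :=
  ⟨Matrix.diagonal fun b => if b then -1 else 1, by
    rw [Matrix.mem_unitaryGroup_iff, Matrix.star_eq_conjTranspose, Matrix.diagonal_conjTranspose,
      Matrix.diagonal_mul_diagonal, ← Matrix.diagonal_one]
    congr 1; ext b; cases b <;> simp⟩

lemma exists_phase_layer (k : ℕ) (S : Finset Q) : ∃ L : Layer Q k, ∀ x : Q → Bool,
    L.apply (ket x) = (∏ q ∈ S, if x q then (-1 : ℂ) else 1) • ket x := by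
  refine ⟨Layer.product k fun q => if q ∈ S then pauliZ else 1, fun x => ?_⟩
  ext y
  rw [Layer.product_apply_ket]
  by_cases hy : y = x
  · subst hy
    simp only [ket, if_true, Pi.smul_apply, smul_eq_mul, mul_one]
    rw [← Finset.prod_subset (Finset.subset_univ S)]
    · exact Finset.prod_congr rfl fun q hq => by simp [hq, pauliZ]
    · intro q _ hq; simp [hq]
  · obtain ⟨q, hq⟩ := Function.ne_iff.1 hy
    simp only [ket, if_neg hy, Pi.smul_apply, smul_zero]
    refine Finset.prod_eq_zero (Finset.mem_univ q) ?_
    by_cases hqS : q ∈ S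
    · simp [hqS, pauliZ, Matrix.diagonal_apply_ne _ hq]
    · simp [hqS, Matrix.one_apply_ne hq]

/-- A diagonal operator whose phases are computed classically. -/
lemma exists_phase_circuit {R : Circuit Q k} (hR : R.IsClassical) (S : Finset Q) :
    ∃ C : Circuit Q k, C.length = 2 * R.length + 1 ∧ ∀ x : Q → Bool,
      C.apply (ket x) = (∏ q ∈ S, if R.perm x q then (-1 : ℂ) else 1) • ket x := by
  obtain ⟨L, hL⟩ := exists_phase_layer k S
  -- Compute, apply `Z` on `S`, uncompute.
  refine ⟨R ++ L :: R.reverse, by simp; ring, fun x => ?_⟩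
  rw [Circuit.apply_append, Circuit.apply_cons, hR.apply_ket, hL,
    (Circuit.isLinearMap_apply _).map_smul, hR.reverse.apply_ket, Circuit.perm_reverse_perm]

end Product

/-! ### Fanout trees -/

section Copy

variable {Q J : Type} [DecidableEq Q] [Fintype J] {n K : ℕ}

/-- One level of a fanout tree on registers indexed by `Fin K → Fin (n + 1)`: each qubit whose
index vanishes from coordinate `s` on is copied to the `n` qubits obtained by changing that
coordinate. -/
lemma exists_fanout_layer (r : J → (Fin K → Fin (n + 1)) → Q)
    (hr : Function.Injective fun p : J × (Fin K → Fin (n + 1)) => r p.1 p.2) (s : Fin K) :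
    ∃ L : Layer Q n, L.IsClassical ∧ ∀ x,
      (∀ j w, L.perm x (r j w) = if (∀ i, s < i → w i = 0) ∧ w s ≠ 0 then
        xor (x (r j w)) (x (r j (Function.update w s 0))) else x (r j w)) ∧
      ∀ q, (∀ j w, q ≠ r j w) → L.perm x q = x q := by
  have hr' : ∀ {j j' w w'}, r j w = r j' w' ↔ j = j' ∧ w = w' := fun {j j' w w'} => by
    simpa using hr.eq_iff (a := (j, w)) (b := (j', w'))
  -- The sources. Each has exactly `n` targets, one per nonzero value of coordinate `s`; hence the
  -- base `n + 1`.
  let ι := {p : J × (Fin K → Fin (n + 1)) // ∀ i, s ≤ i → p.2 i = 0}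
  let T : ι → Finset Q := fun p =>
    (Finset.univ.erase 0).image fun a => r p.1.1 (Function.update p.1.2 s a)
  have hT : ∀ p q, q ∈ T p ↔ ∃ a ≠ 0, r p.1.1 (Function.update p.1.2 s a) = q := fun p q => by
    simp [T]
  have hns : ∀ p : ι, r p.1.1 p.1.2 ∉ T p := by
    intro p hp
    obtain ⟨a, ha, h⟩ := (hT _ _).1 hp
    have := congrFun (hr'.1 h).2 s
    rw [Function.update_self, p.2 s le_rfl] at this
    exact ha this
  have hcard : ∀ p : ι, (T p).card = n := by
    intro p
    rw [Finset.card_image_of_injective, Finset.card_erase_of_mem (Finset.mem_univ _)]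
    · simp
    · intro a b h
      simpa using congrFun (hr'.1 h).2 s
  let g : ι → Gate Q n := fun p => Gate.fanout (r p.1.1 p.1.2) (T p) (hns p) (hcard p)
  have hsupp : ∀ p q, q ∈ (g p).support ↔ ∃ a, r p.1.1 (Function.update p.1.2 s a) = q := by
    intro p q
    simp only [g, Gate.support, Finset.mem_insert, hT]
    have h0 : Function.update p.1.2 s 0 = p.1.2 :=
      Function.update_eq_self_iff.2 (p.2 s le_rfl).symm
    constructor
    · rintro (rfl | ⟨a, -, rfl⟩)
      exacts [⟨0, by rw [h0]⟩, ⟨a, rfl⟩]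
    · rintro ⟨a, rfl⟩
      by_cases ha : a = 0
      · left; rw [ha, h0]
      · exact Or.inr ⟨a, ha, rfl⟩
  have hg : Pairwise fun p p' => Disjoint (g p).support (g p').support := by
    intro p p' hpp
    rw [Finset.disjoint_left]
    intro q hq hq'
    obtain ⟨a, rfl⟩ := (hsupp _ _).1 hq
    obtain ⟨a', h⟩ := (hsupp _ _).1 hq'
    obtain ⟨h1, h2⟩ := hr'.1 h
    refine hpp (Subtype.ext (Prod.ext h1.symm (funext fun i => ?_)))
    by_cases hi : i = s
    · rw [hi, p.2 s le_rfl, p'.2 s le_rfl]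
    · simpa [hi] using (congrFun h2 i).symm
  refine ⟨Layer.ofFamily g hg, ?_, fun x => ⟨fun j w => ?_, fun q hq => ?_⟩⟩
  · intro g' hg'
    obtain ⟨p, rfl⟩ := Layer.mem_ofFamily.1 hg'
    exact Gate.isClassical_fanout _ _ (hns p) (hcard p)
  · by_cases hw : ∀ i, s < i → w i = 0
    · let p : ι := ⟨(j, Function.update w s 0), fun i hi => by
        rcases hi.eq_or_lt with rfl | hi
        · simp
        · simpa [hi.ne'] using hw i hi⟩
      have hw' : Function.update (Function.update w s 0) s (w s) = w := by simp
      rw [Layer.perm_of_mem (g := g p) _ _ (Layer.mem_ofFamily.2 ⟨p, rfl⟩)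
        ((hsupp _ _).2 ⟨w s, by simp [p]⟩)]
      have hm : r j w ∈ T p ↔ w s ≠ 0 := by
        rw [hT]
        constructor
        · rintro ⟨a, ha, h⟩
          have := congrFun (hr'.1 h).2 s
          simp only [p, Function.update_self] at this
          exact this ▸ ha
        · exact fun h => ⟨w s, h, by simp [p]⟩
      have hand : ((∀ i, s < i → w i = 0) ∧ w s ≠ 0) ↔ w s ≠ 0 := and_iff_right hw
      simp only [g, Gate.perm, hm, hand]
      rfl
    · rw [if_neg fun h => hw h.1, Layer.perm_of_forall_notMem]
      intro g' hg' hq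
      obtain ⟨p, rfl⟩ := Layer.mem_ofFamily.1 hg'
      obtain ⟨a, h⟩ := (hsupp _ _).1 hq
      refine hw fun i hi => ?_
      rw [← (hr'.1 h).2, Function.update_of_ne hi.ne', p.2 i hi.le]
  · rw [Layer.perm_of_forall_notMem]
    intro g' hg' hq'
    obtain ⟨p, rfl⟩ := Layer.mem_ofFamily.1 hg'
    obtain ⟨a, h⟩ := (hsupp _ _).1 hq'
    exact hq _ _ h.symm

/-- Copying `|J|` bits to `(n + 1) ^ K` qubits each with `K` layers of fanout gates. -/
lemma exists_copy_circuit (r : J → (Fin K → Fin (n + 1)) → Q)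
    (hr : Function.Injective fun p : J × (Fin K → Fin (n + 1)) => r p.1 p.2) :
    ∃ C : Circuit Q n, C.IsClassical ∧ C.length = K ∧
      ∀ x : Q → Bool, (∀ j w, w ≠ 0 → x (r j w) = false) →
        (∀ j w, C.perm x (r j w) = x (r j 0)) ∧
        ∀ q, (∀ j w, q ≠ r j w) → C.perm x q = x q := by
  -- Invariant: after `s` levels the bit sits at the `(n + 1) ^ s` indices vanishing from coordinate
  -- `s` on, and all other copies are still zero.
  have aux : ∀ s ≤ K, ∃ C : Circuit Q n, C.IsClassical ∧ C.length = s ∧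
      ∀ x : Q → Bool, (∀ j w, w ≠ 0 → x (r j w) = false) →
        (∀ j w, C.perm x (r j w) =
          if ∀ i : Fin K, s ≤ i → w i = 0 then x (r j 0) else false) ∧
        ∀ q, (∀ j w, q ≠ r j w) → C.perm x q = x q := by
    intro s
    induction s with
    | zero =>
      refine fun _ => ⟨[], Circuit.isClassical_nil, rfl, fun x hx => ⟨fun j w => ?_, by simp⟩⟩
      by_cases hw : w = 0
      · simp [hw]
      · have : ¬ ∀ i, w i = 0 := fun h => hw (funext h)
        simpa [this] using hx j w hw
    | succ s ih =>
      intro hs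
      obtain ⟨C, hC, hl, h⟩ := ih (by omega)
      obtain ⟨L, hL, hLx⟩ := exists_fanout_layer r hr ⟨s, hs⟩
      refine ⟨C ++ [L], hC.append (Circuit.isClassical_nil.cons hL), by simp [hl],
        fun x hx => ⟨fun j w => ?_, fun q hq => ?_⟩⟩
      · obtain ⟨h1, -⟩ := h x hx
        simp only [Circuit.perm_append, Circuit.perm_cons, Circuit.perm_nil, (hLx _).1, h1]
        have e1 : (∀ i : Fin K, ⟨s, hs⟩ < i → w i = 0) ↔ ∀ i : Fin K, s + 1 ≤ i → w i = 0 :=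
          forall_congr' fun i => by rw [Fin.lt_def, Nat.succ_le_iff]
        have e2 : (∀ i : Fin K, s ≤ i → w i = 0) ↔
            (∀ i : Fin K, s + 1 ≤ i → w i = 0) ∧ w ⟨s, hs⟩ = 0 := by
          constructor
          · exact fun H => ⟨fun i hi => H i (by omega), H _ le_rfl⟩
          · rintro ⟨H, H0⟩ i hi
            rcases hi.eq_or_lt with hi | hi
            · rw [← H0]; congr 1; exact Fin.ext hi.symm
            · exact H i hi
        have e3 : (∀ i : Fin K, s ≤ i → Function.update w ⟨s, hs⟩ 0 i = 0) ↔
            ∀ i : Fin K, s + 1 ≤ i → w i = 0 := by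
          constructor
          · intro H i hi
            have hne : i ≠ ⟨s, hs⟩ := fun e => by simp [e] at hi
            simpa [hne] using H i (by omega)
          · intro H i hi
            by_cases hne : i = ⟨s, hs⟩
            · simp [hne]
            · have : (i : ℕ) ≠ s := fun e => hne (Fin.ext e)
              simpa [hne] using H i (by omega)
        simp only [e1, e2, e3]
        by_cases hB : w ⟨s, hs⟩ = 0 <;> simp [hB]
      · simp only [Circuit.perm_append, Circuit.perm_cons, Circuit.perm_nil]
        rw [(hLx _).2 q hq, (h x hx).2 q hq]
  obtain ⟨C, hC, hl, h⟩ := aux K le_rfl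
  refine ⟨C, hC, hl, fun x hx => ⟨fun j w => ?_, (h x hx).2⟩⟩
  rw [(h x hx).1, if_pos fun i hi => absurd i.2 (by omega)]

end Copy

/-! ### Relabelling qubits -/

section Map

variable {Q Q' : Type} [DecidableEq Q] [DecidableEq Q'] {k : ℕ}

/-- Relabelling the qubits of a gate. -/
def Gate.map (e : Q ≃ Q') : Gate Q k → Gate Q' k
  | single q U => single (e q) U
  | toffoli c t h => toffoli (c.map e.toEmbedding) (e t) (by simpa using h)
  | fanout s t h hk => fanout (e s) (t.map e.toEmbedding) (by simpa using h) (by simpa using hk)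

lemma Gate.support_map (e : Q ≃ Q') (g : Gate Q k) :
    (g.map e).support = g.support.map e.toEmbedding := by
  cases g <;> simp [Gate.map, support]

lemma Gate.map_apply (e : Q ≃ Q') (g : Gate Q k) (ψ : Vec Q) :
    (g.map e).apply (fun x => ψ (x ∘ e)) = fun x => g.apply ψ (x ∘ e) := by
  ext x
  cases g with
  | single q U =>
    simp only [Gate.map, apply, Function.update_comp_eq_of_injective _ e.injective,
      Function.comp_apply]
  | toffoli c t h =>
    have : (∀ a ∈ c.map e.toEmbedding, x a = true) ↔ ∀ a ∈ c, (x ∘ e) a = true :=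
      Finset.forall_mem_map
    simp only [Gate.map, apply, this]
    congr 1
    split_ifs
    · exact Function.update_comp_eq_of_injective _ e.injective _ _
    · rfl
  | fanout s t h hk =>
    simp only [Gate.map, apply]
    congr 1
    ext q
    simp

/-- Relabelling the qubits of a layer. -/
def Layer.map (e : Q ≃ Q') (L : Layer Q k) : Layer Q' k where
  gates := L.gates.map (Gate.map e)
  disjoint := by
    rw [List.pairwise_map]
    refine L.disjoint.imp fun h => ?_
    rwa [Gate.support_map, Gate.support_map, Finset.disjoint_map]

lemma Layer.map_apply (e : Q ≃ Q') (L : Layer Q k) (ψ : Vec Q) :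
    (L.map e).apply (fun x => ψ (x ∘ e)) = fun x => L.apply ψ (x ∘ e) := by
  have aux : ∀ (l : List (Gate Q k)) (ψ : Vec Q),
      (l.map (Gate.map e)).foldl (fun φ g => g.apply φ) (fun x => ψ (x ∘ e)) =
        fun x => l.foldl (fun φ g => g.apply φ) ψ (x ∘ e) := by
    intro l
    induction l with
    | nil => intro ψ; rfl
    | cons g l ih => intro ψ; simp only [List.map_cons, List.foldl_cons, Gate.map_apply, ih]
  exact aux _ ψ

lemma Circuit.map_apply (e : Q ≃ Q') (C : Circuit Q k) (ψ : Vec Q) :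
    Circuit.apply (C.map (Layer.map e)) (fun x => ψ (x ∘ e)) = fun x => C.apply ψ (x ∘ e) := by
  induction C generalizing ψ with
  | nil => rfl
  | cons L C ih => simp only [List.map_cons, apply_cons, Layer.map_apply, ih]

/-- Allows circuits on any convenient qubit type: the qubits in the range of `f` carry the state,
and the rest are numbered as ancillae. -/
lemma CleanlyPreparable.of_circuit [Fintype Q] {n d s : ℕ} (f : Fin n → Q)
    (hf : Function.Injective f) (hs : Fintype.card Q ≤ s) (C : Circuit Q k) (hd : C.length ≤ d)
    (ψ : Vec (Fin n))
    (h : ∀ x, C.apply (ket fun _ => false) x =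
      if ∀ q, (∀ i, q ≠ f i) → x q = false then ψ (x ∘ f) else 0) :
    CleanlyPreparable k d s ψ := by
  classical
  let A := ((Set.range f)ᶜ : Set Q)
  let e' : Fin n ⊕ Fin (Fintype.card A) ≃ Q :=
    ((Equiv.ofInjective f hf).sumCongr (Fintype.equivFin A).symm).trans
      (Equiv.Set.sumCompl (Set.range f))
  have he1 : ∀ i, e' (Sum.inl i) = f i := fun i => rfl
  have he2 : ∀ q, (∀ i, q ≠ f i) ↔ ∃ j, e' (Sum.inr j) = q := by
    intro q
    constructor
    · intro hq
      exact ⟨Fintype.equivFin A ⟨q, by rintro ⟨i, rfl⟩; exact hq i rfl⟩, by simp [e']; rfl⟩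
    · rintro ⟨j, rfl⟩ i hi
      rw [← he1] at hi
      simpa using e'.injective hi
  refine ⟨Fintype.card A, (Fintype.card_subtype_le _).trans hs, C.map (Layer.map e'.symm),
    by simpa [Circuit.depth] using hd, ?_⟩
  have hket : (ket fun _ => false : Vec (Fin n ⊕ Fin (Fintype.card A))) =
      fun x => (ket fun _ => false : Vec Q) (x ∘ e'.symm) := by
    ext x
    have : x = (fun _ => false) ↔ x ∘ e'.symm = fun _ => false := by
      constructor
      · rintro rfl; rfl
      · intro hx; ext q; simpa using congrFun hx (e' q)
    simp only [ket, this]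
  rw [CleanlyPrepares, hket, Circuit.map_apply]
  ext x
  rw [h]
  have h1 : (∀ q, (∀ i, q ≠ f i) → (x ∘ e'.symm) q = false) ↔ ∀ j, x (Sum.inr j) = false := by
    simp only [he2]
    constructor
    · intro H j; simpa using H _ ⟨j, rfl⟩
    · rintro H _ ⟨j, rfl⟩; simpa using H j
  have h2 : (x ∘ e'.symm) ∘ f = fun i => x (Sum.inl i) := by
    ext i; simp [← he1]
  simp only [withZeros, h1, h2]

end Map

/-! ### Exact amplitude amplification -/

section Grover

variable {Q : Type} [Fintype Q] [DecidableEq Q] {k : ℕ}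

/-- A vector all of whose amplitudes lie on strings that vanish outside `D`. -/
def SupportedOn (D : Finset Q) (ψ : Vec Q) : Prop := ∀ x, (∃ q ∉ D, x q = true) → ψ x = 0

lemma SupportedOn.product_apply {D : Finset Q} {ψ : Vec Q} (hψ : SupportedOn D ψ)
    {U : Q → Matrix.unitaryGroup Bool ℂ} (hU : ∀ q ∉ D, U q = 1) :
    SupportedOn D ((Layer.product k U).apply ψ) := by
  rintro x ⟨q, hq, hx⟩
  rw [Layer.product_apply]
  refine Finset.sum_eq_zero fun z _ => ?_
  cases hz : z q
  · rw [Finset.prod_eq_zero (Finset.mem_univ q) (by simp [hU q hq, hx, hz]), mul_zero]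
  · rw [hψ z ⟨q, hq, hz⟩, zero_mul]

/-- The oracles are correct only when their workspace is zero; this suffices for vectors supported
on `D`. -/
lemma SupportedOn.circuit_apply {D : Finset Q} {ψ : Vec Q} (hψ : SupportedOn D ψ)
    {C : Circuit Q k} {s : (Q → Bool) → ℂ}
    (hC : ∀ x : Q → Bool, (∀ q ∉ D, x q = false) → C.apply (ket x) = s x • ket x) :
    C.apply ψ = fun x => s x * ψ x := by
  conv_lhs => rw [eq_sum_smul_ket ψ, C.isLinearMap_apply.map_sum_smul]
  conv_rhs => rw [eq_sum_smul_ket (fun x => s x * ψ x)]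
  refine Finset.sum_congr rfl fun x _ => ?_
  by_cases hx : ∀ q ∉ D, x q = false
  · rw [hC x hx, smul_smul, mul_comm]
  · rw [hψ x (by simpa using hx), mul_zero, zero_smul, zero_smul]

/-- One step of amplitude amplification, starting from a product state with good part of squared
norm `1 / 4`, yields a state that is good exactly. -/
lemma exists_amplification_circuit {D : Finset Q} {U : Q → Matrix.unitaryGroup Bool ℂ}
    (hU : ∀ q ∉ D, U q = 1) {G : Finset (Q → Bool)} {C₁ C₂ : Circuit Q k}
    (h₁ : ∀ x : Q → Bool, (∀ q ∉ D, x q = false) →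
      C₁.apply (ket x) = (if x ∈ G then (-1 : ℂ) else 1) • ket x)
    (h₂ : ∀ x : Q → Bool, (∀ q ∉ D, x q = false) →
      C₂.apply (ket x) = (if x = (fun _ => false) then (-1 : ℂ) else 1) • ket x)
    (hG : ∑ x ∈ G, ‖∏ q, (U q).1 (x q) false‖ ^ 2 = 1 / 4) :
    ∃ C : Circuit Q k, C.length = C₁.length + C₂.length + 3 ∧
      C.apply (ket fun _ => false) = ∑ x ∈ G, (-2 * ∏ q, (U q).1 (x q) false) • ket x := by
  let A := Layer.product k U
  let B := Layer.product k fun q => star (U q)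
  -- Write `φ = A|0⟩`, with good part `φ_G`. After `C₁` the vector is `v = φ - 2 φ_G`, and `B v` has
  -- amplitude `⟨φ, v⟩ = 1 - 2/4 = 1/2` at zero. Negating that amplitude subtracts exactly `|0⟩`, so
  -- the last `A` yields `v - φ = -2 φ_G`.
  refine ⟨A :: C₁ ++ B :: C₂ ++ [A], by simp; ring, ?_⟩
  set φ : Vec Q := A.apply (ket fun _ => false) with hφ
  have hφx : ∀ x, φ x = ∏ q, (U q).1 (x q) false := fun x => Layer.product_apply_ket U _ x
  have hs0 : SupportedOn D (ket fun _ => false) := by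
    rintro x ⟨q, -, hx⟩
    rw [ket, if_neg]
    rintro rfl
    simp at hx
  have hsφ : SupportedOn D φ := hs0.product_apply hU
  have hAB : ∀ ψ, A.apply (B.apply ψ) = ψ := Layer.product_product_apply _ _ fun q => by simp
  have hBA : ∀ ψ, B.apply (A.apply ψ) = ψ := Layer.product_product_apply _ _ fun q => by simp
  have hB0 : ∀ ψ : Vec Q, B.apply ψ (fun _ => false) = ∑ z, ψ z * star (φ z) := by
    intro ψ
    rw [Layer.product_apply]
    simp [hφx, Matrix.star_apply]
  set v : Vec Q := fun x => (if x ∈ G then (-1 : ℂ) else 1) * φ x with hv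
  have hsv : SupportedOn D v := fun x hx => by simp only [hv, hsφ x hx, mul_zero]
  have hsw : SupportedOn D (B.apply v) := hsv.product_apply fun q hq => by simp [hU q hq]
  have hw0 : B.apply v (fun _ => false) = 1 / 2 := by
    have h1 : ∑ z, φ z * star (φ z) = 1 := by
      rw [← hB0, hφ, hBA]; simp [ket]
    have h2 : ∑ z ∈ G, φ z * star (φ z) = 1 / 4 := by
      have h3 := congrArg (fun r : ℝ => (r : ℂ)) hG
      push_cast at h3
      rw [← h3]
      refine Finset.sum_congr rfl fun z _ => ?_
      rw [← hφx]
      exact Complex.mul_conj' _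
    rw [hB0]
    have h3 : ∀ z, v z * star (φ z) =
        φ z * star (φ z) - 2 * (if z ∈ G then φ z * star (φ z) else 0) := by
      intro z; simp only [hv]; split_ifs <;> ring
    simp only [h3, Finset.sum_sub_distrib, h1, ← Finset.mul_sum]
    rw [Finset.sum_ite_mem, Finset.univ_inter, h2]
    norm_num
  have hC₂ : C₂.apply (B.apply v) = B.apply v + (-1 : ℂ) • ket fun _ => false := by
    rw [hsw.circuit_apply h₂]
    ext x
    simp only [Pi.add_apply, Pi.smul_apply, ket, smul_eq_mul]
    split_ifs with hx
    · rw [hx, hw0]; norm_num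
    · ring
  have hC₁ : C₁.apply φ = v := hsφ.circuit_apply h₁
  rw [Circuit.apply_append, Circuit.apply_append, Circuit.apply_cons, Circuit.apply_cons,
    Circuit.apply_cons, Circuit.apply_nil, ← hφ, hC₁, hC₂, A.isLinearMap_apply.map_add,
    A.isLinearMap_apply.map_smul, hAB, ← hφ]
  ext x
  simp only [Pi.add_apply, Pi.smul_apply, ket, smul_eq_mul, Finset.sum_apply, ← hφx, hv]
  simp only [mul_ite, mul_one, mul_zero, Finset.sum_ite_eq]
  split_ifs <;> ring

/-- Any unit vector is the first column of a unitary matrix. -/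
lemma exists_unitary_column (a b : ℂ) (h : ‖a‖ ^ 2 + ‖b‖ ^ 2 = 1) :
    ∃ V : Matrix.unitaryGroup Bool ℂ, V.1 false false = a ∧ V.1 true false = b := by
  have h' : (starRingEnd ℂ) a * a + (starRingEnd ℂ) b * b = 1 := by
    rw [Complex.conj_mul', Complex.conj_mul']
    exact_mod_cast h
  refine ⟨⟨Matrix.of fun x y => match x, y with
    | false, false => a
    | true, false => b
    | false, true => -(starRingEnd ℂ) b
    | true, true => (starRingEnd ℂ) a, ?_⟩, rfl, rfl⟩
  rw [Matrix.mem_unitaryGroup_iff']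
  ext x y
  cases x <;> cases y <;>
    simp [Matrix.mul_apply, Matrix.star_apply] <;>
    first | linear_combination h' | ring

/-- Intermediate value theorem on `[0, 1]`: the expression is `0` at `t = 0`, and at least `1/2` at
`t = 1` because `∏ (1 + r i) ≤ exp (∑ r i) = e < 4`. -/
lemma exists_mul_prod_inv_sqrt_eq_half {I : Type} [Fintype I] (r : I → ℝ) (h0 : ∀ i, 0 ≤ r i)
    (h1 : ∑ i, r i = 1) : ∃ t : ℝ, t * ∏ i, (√(1 + t ^ 2 * r i))⁻¹ = 1 / 2 := by
  have hpos : ∀ (t : ℝ) i, 0 < 1 + t ^ 2 * r i := fun t i => by have := h0 i; positivity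
  have hcont : Continuous fun t : ℝ => t * ∏ i, (√(1 + t ^ 2 * r i))⁻¹ := by
    refine continuous_id.mul (continuous_finsetProd _ fun i _ => Continuous.inv₀ (by fun_prop) ?_)
    exact fun t => (Real.sqrt_pos.2 (hpos t i)).ne'
  have hP : ∏ i, √(1 + r i) ≤ 2 := by
    have hsq : (∏ i, √(1 + r i)) ^ 2 ≤ 2 ^ 2 := by
      rw [← Finset.prod_pow]
      calc ∏ i, √(1 + r i) ^ 2 ≤ ∏ i, Real.exp (r i) :=
            Finset.prod_le_prod (fun _ _ => by positivity) fun i _ => by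
              rw [Real.sq_sqrt (by linarith [h0 i]), add_comm]
              exact Real.add_one_le_exp _
        _ = Real.exp 1 := by rw [← Real.exp_sum, h1]
        _ ≤ 2 ^ 2 := by linarith [Real.exp_one_lt_d9]
    exact le_of_sq_le_sq hsq (by norm_num)
  have hmem : (1 / 2 : ℝ) ∈ Set.Icc ((0 : ℝ) * ∏ i, (√(1 + (0 : ℝ) ^ 2 * r i))⁻¹)
      (1 * ∏ i, (√(1 + (1 : ℝ) ^ 2 * r i))⁻¹) := by
    refine ⟨by rw [zero_mul]; norm_num, ?_⟩
    simp only [one_pow, one_mul, Finset.prod_inv_distrib]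
    rw [one_div]
    refine inv_anti₀ (Finset.prod_pos fun i _ => Real.sqrt_pos.2 ?_) hP
    linarith [h0 i]
  obtain ⟨t, -, ht⟩ := intermediate_value_Icc zero_le_one hcont.continuousOn hmem
  exact ⟨t, ht⟩

end Grover

/-! ### Layout of the qubits -/

/-- The qubits of the preparation circuits: registers of `(n + 1) ^ K` copies for the one-hot
encoding and for the binary encoding, one flag for each one-hot string, and one further qubit. -/
inductive Qubit (I J : Type) (n K : ℕ) : Type
  | hot (i : I) (w : Fin K → Fin (n + 1))
  | bin (j : J) (w : Fin K → Fin (n + 1))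
  | flag (i : I)
  | anc

namespace Qubit

variable {I J : Type} {n K : ℕ}

/-- The qubits as a disjoint sum. -/
def equivSum (I J : Type) (n K : ℕ) : Qubit I J n K ≃
    ((I × (Fin K → Fin (n + 1))) ⊕ (J × (Fin K → Fin (n + 1)))) ⊕ (I ⊕ Unit) where
  toFun
    | hot i w => .inl (.inl (i, w))
    | bin j w => .inl (.inr (j, w))
    | flag i => .inr (.inl i)
    | anc => .inr (.inr ())
  invFun
    | .inl (.inl p) => hot p.1 p.2
    | .inl (.inr p) => bin p.1 p.2
    | .inr (.inl i) => flag i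
    | .inr (.inr _) => anc
  left_inv q := by cases q <;> rfl
  right_inv q := by rcases q with (_ | _) | (_ | _) <;> rfl

instance [DecidableEq I] [DecidableEq J] : DecidableEq (Qubit I J n K) :=
  (equivSum I J n K).decidableEq

instance [Fintype I] [Fintype J] : Fintype (Qubit I J n K) :=
  Fintype.ofEquiv _ (equivSum I J n K).symm

lemma card [Fintype I] [Fintype J] : Fintype.card (Qubit I J n K) =
    Fintype.card I * (n + 1) ^ K + Fintype.card J * (n + 1) ^ K + (Fintype.card I + 1) := by
  rw [Fintype.card_congr (equivSum I J n K)]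
  simp

variable [DecidableEq I] [DecidableEq J]

/-- The string that is one exactly at the first copy of the one-hot bit `i`. -/
def hotString (i : I) : Qubit I J n K → Bool := fun q => decide (q = hot i 0)

/-- The string that holds `b` in the first copy of the binary register. -/
def binString (b : J → Bool) : Qubit I J n K → Bool
  | bin j w => b j && decide (w = 0)
  | _ => false

variable [Fintype I] [Fintype J]

/-! ### The two reflections and the one-hot preparation -/

/-- The first copy of the one-hot register. -/
def hotSet (I J : Type) (n K : ℕ) [DecidableEq I] [DecidableEq J] [Fintype I] :
    Finset (Qubit I J n K) := Finset.univ.image fun i => hot i 0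

omit [Fintype J] in
lemma mem_hotSet {q : Qubit I J n K} : q ∈ hotSet I J n K ↔ ∃ i, hot i 0 = q := by
  simp [hotSet]

/-- Negating the register turns the test for zero into one Toffoli gate onto `anc`, which starts at
zero. -/
lemma exists_zero_oracle : ∃ C : Circuit (Qubit I J n K) n, C.length = 5 ∧
    ∀ x : Qubit I J n K → Bool, (∀ q ∉ hotSet I J n K, x q = false) →
      C.apply (ket x) = (if x = (fun _ => false) then (-1 : ℂ) else 1) • ket x := by
  obtain ⟨N, hN, hNx⟩ := exists_not_layer n (hotSet I J n K)
  obtain ⟨T, hT, hTx, -⟩ := exists_toffoli_layer (ι := Unit) n (fun _ => hotSet I J n K)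
    (fun _ => anc) (by simp [mem_hotSet]) (fun i j h => absurd rfl h)
  have hR : Circuit.IsClassical [N, T] := .cons hN (.cons hT Circuit.isClassical_nil)
  obtain ⟨C, hC, h⟩ := exists_phase_circuit hR {anc}
  refine ⟨C, hC, fun x hx => ?_⟩
  have hanc : anc ∉ hotSet I J n K := by simp [mem_hotSet]
  have e : Circuit.perm [N, T] x anc = true ↔ x = fun _ => false := by
    simp only [Circuit.perm_cons, Circuit.perm_nil]
    rw [hTx _ ()]
    simp only [hNx, hx _ hanc, hanc, decide_false, Bool.xor_false, Bool.false_xor,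
      decide_eq_true_eq]
    constructor
    · intro H
      ext q
      by_cases hq : q ∈ hotSet I J n K
      · simpa [hq] using H q hq
      · exact hx q hq
    · rintro rfl q hq
      simp [hq]
  rw [h, Finset.prod_singleton]
  simp only [e]

omit [DecidableEq I] [DecidableEq J] [Fintype I] [Fintype J] in
lemma hot_injective :
    Function.Injective fun p : I × (Fin K → Fin (n + 1)) => (hot p.1 p.2 : Qubit I J n K) :=
  fun p q h => by simpa [Prod.ext_iff] using h

omit [DecidableEq I] [DecidableEq J] [Fintype I] [Fintype J] in
lemma bin_injective :
    Function.Injective fun p : J × (Fin K → Fin (n + 1)) => (bin p.1 p.2 : Qubit I J n K) :=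
  fun p q h => by simpa [Prod.ext_iff] using h

/-- Candidate `i` owns copy `e i` of the register. Negating every bit but the `i`-th there turns
equality with the `i`-th one-hot string into a conjunction, written to `flag i`. At most one flag is
raised, so the product of the phases is the required sign. -/
lemma exists_oneHot_oracle {e : I → Fin K → Fin (n + 1)} (he : Function.Injective e) :
    ∃ C : Circuit (Qubit I J n K) n, C.length = 2 * K + 5 ∧
    ∀ x : Qubit I J n K → Bool, (∀ q ∉ hotSet I J n K, x q = false) →
      C.apply (ket x) = (if x ∈ Finset.univ.image hotString then (-1 : ℂ) else 1) • ket x := by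
  obtain ⟨P, hP, hPl, hPx⟩ := exists_copy_circuit (Q := Qubit I J n K) hot hot_injective
  obtain ⟨N, hN, hNx⟩ := exists_not_layer n
    ((Finset.univ.filter fun p : I × I => p.1 ≠ p.2).image
      fun p => (hot p.1 (e p.2) : Qubit I J n K))
  obtain ⟨T, hT, hTx, -⟩ := exists_toffoli_layer (Q := Qubit I J n K) n
    (fun i : I => Finset.univ.image fun j => hot j (e i)) flag (by simp) (fun i j h => by
      refine Finset.disjoint_left.2 ?_
      simp only [Finset.mem_insert, Finset.mem_image, Finset.mem_univ, true_and]
      rintro _ (rfl | ⟨a, rfl⟩)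
      · simp [h]
      · simp [he.eq_iff, h.symm])
  have hR : Circuit.IsClassical (P ++ [N, T]) :=
    hP.append (.cons hN (.cons hT Circuit.isClassical_nil))
  obtain ⟨C, hC, h⟩ := exists_phase_circuit hR (Finset.univ.image flag)
  refine ⟨C, by rw [hC]; simp [hPl]; ring, fun x hx => ?_⟩
  have hx' : ∀ i w, w ≠ 0 → x (hot i w) = false := fun i w hw =>
    hx _ (by simp [mem_hotSet, hw.symm])
  obtain ⟨h1, h2⟩ := hPx x hx'
  have e1 : ∀ i, Circuit.perm (P ++ [N, T]) x (flag i) = true ↔ x = hotString i := by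
    intro i
    simp only [Circuit.perm_append, Circuit.perm_cons, Circuit.perm_nil]
    rw [hTx]
    simp only [hNx]
    rw [h2 (flag i) (by simp), hx (flag i) (by simp [mem_hotSet])]
    have h3 : ∀ j, hot j (e i) ∈ ((Finset.univ.filter fun p : I × I => p.1 ≠ p.2).image
      fun p => (hot p.1 (e p.2) : Qubit I J n K)) ↔ j ≠ i := by
      intro j; simp [he.eq_iff]
    simp only [Finset.mem_image, Finset.mem_univ, true_and, forall_exists_index,
      forall_apply_eq_imp_iff, h1] at h3 ⊢
    simp only [h3]
    have h4 : (∀ j, (x (hot j 0) ^^ decide (j ≠ i)) = true) ↔ x = hotString i := by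
      constructor
      · intro H
        ext q
        by_cases hq : q ∈ hotSet I J n K
        · obtain ⟨j, rfl⟩ := mem_hotSet.1 hq
          have := H j
          by_cases hj : j = i <;> simpa [hotString, hj] using this
        · rw [hx q hq, hotString, eq_comm, decide_eq_false_iff_not]
          rintro rfl
          exact hq (mem_hotSet.2 ⟨i, rfl⟩)
      · rintro rfl j
        by_cases hj : j = i <;> simp [hotString, hj]
    simpa using h4
  rw [h]
  congr 1
  rw [Finset.prod_image (fun a _ b _ h => by simpa using h)]
  simp only [e1]
  have hinj : Function.Injective (hotString : I → Qubit I J n K → Bool) := fun a b h => by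
    simpa [hotString] using congrFun h (hot a 0)
  by_cases hxm : ∃ i, x = hotString i
  · obtain ⟨i, rfl⟩ := hxm
    simp [hinj.eq_iff]
  · have : x ∉ Finset.univ.image (hotString : I → Qubit I J n K → Bool) := by
      simpa [eq_comm] using hxm
    rw [if_neg this]
    push Not at hxm
    simp [hxm]

/-- Preparation of a superposition of one-hot strings. -/
lemma exists_oneHot_circuit {e : I → Fin K → Fin (n + 1)} (he : Function.Injective e) (c : I → ℂ)
    (hc : ∑ i, ‖c i‖ ^ 2 = 1) :
    ∃ C : Circuit (Qubit I J n K) n, C.length = 2 * K + 13 ∧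
      C.apply (ket fun _ => false) = ∑ i, c i • ket (hotString i) := by
  obtain ⟨t, ht⟩ := exists_mul_prod_inv_sqrt_eq_half (fun i => ‖c i‖ ^ 2)
    (fun i => by positivity) hc
  let a : I → ℝ := fun i => (√(1 + t ^ 2 * ‖c i‖ ^ 2))⁻¹
  -- The minus sign cancels against the factor `-2` produced by amplification.
  have hV : ∀ i, ∃ V : Matrix.unitaryGroup Bool ℂ,
      V.1 false false = a i ∧ V.1 true false = -t * c i * a i := by
    intro i
    refine exists_unitary_column _ _ ?_
    have : 0 < 1 + t ^ 2 * ‖c i‖ ^ 2 := by positivity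
    have h2 : a i ^ 2 = (1 + t ^ 2 * ‖c i‖ ^ 2)⁻¹ := by
      simp only [a, inv_pow, Real.sq_sqrt this.le]
    simp only [norm_mul, mul_pow, norm_neg, Complex.norm_real, Real.norm_eq_abs, sq_abs, h2]
    field_simp
  choose V hV0 hV1 using hV
  let U : Qubit I J n K → Matrix.unitaryGroup Bool ℂ
    | hot i w => if w = 0 then V i else 1
    | _ => 1
  have hU : ∀ q ∉ hotSet I J n K, U q = 1 := by
    intro q hq
    rcases q with ⟨i, w⟩ | _ | _ | _
    · have : w ≠ 0 := fun h => hq (mem_hotSet.2 ⟨i, by rw [h]⟩)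
      simp [U, this]
    all_goals rfl
  have hφ : ∀ i, ∏ q, (U q).1 (hotString i q) false = -c i / 2 := by
    intro i
    rw [← Fintype.prod_of_injective (fun j => (hot j 0 : Qubit I J n K))
      (fun a b h => by simpa using h)
      (fun j => if j = i then -t * c i * a i else (a j : ℂ)) _ ?_ ?_]
    · rw [← Finset.mul_prod_erase _ _ (Finset.mem_univ i), if_pos rfl,
        Finset.prod_congr rfl fun j hj => if_neg (Finset.ne_of_mem_erase hj), mul_assoc,
        Finset.mul_prod_erase _ (fun j => (a j : ℂ)) (Finset.mem_univ i)]
      have := congrArg (fun r : ℝ => (r : ℂ)) ht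
      push_cast at this
      simp only [a]
      push_cast
      linear_combination -c i * this
    · intro q hq
      have hq' : q ∉ hotSet I J n K := fun h => hq (by simpa [mem_hotSet] using h)
      have h0 : hotString i q = false := by
        rw [hotString, decide_eq_false_iff_not]
        rintro rfl
        exact hq ⟨i, rfl⟩
      simp [hU q hq', h0]
    · intro j
      by_cases hj : j = i
      · subst hj; simp [U, hotString, hV1]
      · simp [U, hotString, hV0, hj]
  have hinj : Function.Injective (hotString : I → Qubit I J n K → Bool) := fun a b h => by
    simpa [hotString] using congrFun h (hot a 0)
  obtain ⟨C₁, hC₁, h₁⟩ := exists_oneHot_oracle (J := J) he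
  obtain ⟨C₂, hC₂, h₂⟩ := exists_zero_oracle (I := I) (J := J) (n := n) (K := K)
  obtain ⟨C, hC, h⟩ := exists_amplification_circuit hU h₁ h₂ (by
    rw [Finset.sum_image hinj.injOn]
    simp only [hφ, norm_div, norm_neg, div_pow, ← Finset.sum_div, hc]
    norm_num)
  refine ⟨C, by omega, ?_⟩
  rw [h, Finset.sum_image hinj.injOn]
  refine Finset.sum_congr rfl fun i _ => ?_
  rw [hφ]
  congr 1
  ring

end Qubit

/-! ### From one-hot to binary encoding -/

/-- Conjugating a classical layer by a classical circuit. -/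
lemma Circuit.perm_conj {Q : Type} [DecidableEq Q] {k : ℕ} {R : Circuit Q k} {T : Layer Q k}
    {x y : Q → Bool} (h : T.perm (R.perm x) = R.perm y) :
    Circuit.perm (R ++ T :: R.reverse) x = y := by
  rw [perm_append, perm_cons, h, perm_reverse_perm]

/-- Every `X i` vanishes on the ancillae, so a string that is zero there equals `X i` as soon as the
two agree along `f`. -/
lemma CleanlyPreparable.of_sum {Q : Type} [Fintype Q] [DecidableEq Q] {k n d s : ℕ}
    (f : Fin n → Q) (hf : Function.Injective f) (hs : Fintype.card Q ≤ s) (C : Circuit Q k)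
    (hd : C.length ≤ d) {ι : Type} [Fintype ι] (a : ι → ℂ) (X : ι → Q → Bool)
    (hX : ∀ i q, (∀ j, q ≠ f j) → X i q = false)
    (h : C.apply (ket fun _ => false) = ∑ i, a i • ket (X i)) :
    CleanlyPreparable k d s (∑ i, a i • ket (X i ∘ f)) := by
  refine .of_circuit f hf hs C hd _ fun x => ?_
  rw [h]
  simp only [Finset.sum_apply, Pi.smul_apply, ket]
  split_ifs with hx
  · refine Finset.sum_congr rfl fun i _ => ?_
    have : x = X i ↔ x ∘ f = X i ∘ f := by
      refine ⟨fun e => by rw [e], fun e => funext fun q => ?_⟩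
      by_cases hq : ∀ j, q ≠ f j
      · rw [hx q hq, hX i q hq]
      · push Not at hq
        obtain ⟨j, rfl⟩ := hq
        exact congrFun e j
    simp only [this]
  · refine Finset.sum_eq_zero fun i _ => ?_
    rw [if_neg, smul_zero]
    rintro rfl
    exact hx (hX i)

namespace Qubit

variable {J : Type} [Fintype J] [DecidableEq J] {n K : ℕ}

/-- Computing the binary encoding from the one-hot encoding. -/
lemma exists_write_binary_circuit {e : J → Fin K → Fin (n + 1)} (he : Function.Injective e) :
    ∃ C : Circuit (Qubit (J → Bool) J n K) n, C.IsClassical ∧ C.length = 2 * K + 3 ∧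
      ∀ b, C.perm (hotString b) = fun q => xor (hotString b q) (binString b q) := by
  obtain ⟨P, hP, hPl, hPx⟩ := exists_copy_circuit (Q := Qubit (J → Bool) J n K) hot hot_injective
  obtain ⟨N, hN, hNx⟩ := exists_not_layer n (hotSet (J → Bool) J n K)
  -- On a one-hot register, bit `j` of the encoded string is one iff no position `b` with `b j =
  -- false` is hot: a conjunction of negated bits, taken on the copy `e j` reserved for `j`.
  obtain ⟨T, hT, hTx, hTx'⟩ := exists_toffoli_layer (Q := Qubit (J → Bool) J n K) n
    (fun j : J => (Finset.univ.filter fun b : J → Bool => b j = false).image fun b => hot b (e j))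
    (fun j => bin j 0) (by simp) (fun i j h => by
      refine Finset.disjoint_left.2 ?_
      simp only [Finset.mem_insert, Finset.mem_image]
      rintro _ (rfl | ⟨a, -, rfl⟩)
      · simp [h]
      · simp [he.eq_iff, h.symm])
  have hR : Circuit.IsClassical (N :: P) := .cons hN hP
  refine ⟨(N :: P) ++ T :: (N :: P).reverse, hR.append (.cons hT hR.reverse),
    by simp [hPl]; ring, fun b => Circuit.perm_conj ?_⟩
  have hotmem : ∀ c w, (hot c w : Qubit (J → Bool) J n K) ∈ hotSet (J → Bool) J n K ↔ w = 0 := by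
    intro c w; simp [mem_hotSet, eq_comm]
  -- Stated for general `y` so as to cover both the input and the claimed output, which share their
  -- one-hot register. By `Circuit.perm_conj` the two need only be compared after the forward
  -- computation.
  have hot0 : ∀ y : Qubit (J → Bool) J n K → Bool, (∀ c w, y (hot c w) = decide (c = b ∧ w = 0)) →
      (∀ c w, (Circuit.perm (N :: P) y) (hot c w) = !decide (c = b)) ∧
      ∀ q, (∀ c w, q ≠ hot c w) → (Circuit.perm (N :: P) y) q = y q := by
    intro y hy
    obtain ⟨h1, h2⟩ := hPx (N.perm y) (fun c w hw => by
      rw [hNx, hy]; simp [hotmem, hw])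
    refine ⟨fun c w => ?_, fun q hq => ?_⟩
    · rw [Circuit.perm_cons, h1, hNx, hy]; simp [hotmem]
    · have : q ∉ hotSet (J → Bool) J n K := fun h => by
        obtain ⟨c, rfl⟩ := mem_hotSet.1 h
        exact hq c 0 rfl
      rw [Circuit.perm_cons, h2 q hq, hNx]; simp [this]
  obtain ⟨h1, h2⟩ := hot0 (hotString b) fun _ _ => by
    simp [hotString]
  obtain ⟨h3, h4⟩ := hot0 (fun q => xor (hotString b q) (binString b q)) fun _ _ => by
    simp [hotString, binString]
  ext q
  by_cases hq : ∃ j, q = bin j 0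
  · obtain ⟨j, rfl⟩ := hq
    rw [hTx, h2 _ (by simp), h4 _ (by simp)]
    simp only [Finset.mem_image, Finset.mem_filter, Finset.mem_univ, true_and,
      forall_exists_index, and_imp, forall_apply_eq_imp_iff₂, h1]
    congr 1
    rw [binString, decide_eq_true rfl, Bool.and_true]
    cases hb : b j
    · simp [hb]
    · simp only [decide_eq_true_eq]
      rintro c hc
      have : c ≠ b := by rintro rfl; simp [hb] at hc
      simp [this]
  · push Not at hq
    rw [hTx' _ _ hq]
    rcases q with ⟨c, w⟩ | ⟨j, w⟩ | _ | _
    · rw [h1, h3]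
    · have : w ≠ 0 := fun h => hq j (by rw [h])
      rw [h2 _ (by simp), h4 _ (by simp)]; simp [binString, this]
    · rw [h2 _ (by simp), h4 _ (by simp)]; simp [binString]
    · rw [h2 _ (by simp), h4 _ (by simp)]; simp [binString]

/-- Erasing the one-hot encoding by means of the binary encoding. -/
lemma exists_erase_oneHot_circuit {e : (J → Bool) → Fin K → Fin (n + 1)}
    (he : Function.Injective e) :
    ∃ C : Circuit (Qubit (J → Bool) J n K) n, C.IsClassical ∧ C.length = 2 * K + 3 ∧
      ∀ b, C.perm (fun q => xor (hotString b q) (binString b q)) = binString b := by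
  obtain ⟨P, hP, hPl, hPx⟩ := exists_copy_circuit (Q := Qubit (J → Bool) J n K) bin bin_injective
  obtain ⟨N, hN, hNx⟩ := exists_not_layer n
    ((Finset.univ.filter fun p : J × (J → Bool) => p.2 p.1 = false).image
      fun p => (bin p.1 (e p.2) : Qubit (J → Bool) J n K))
  -- Each string `b` is compared with its own copy `e b` of the binary register, after negating the
  -- bits where `b` is zero. Only the encoded string matches, so only the hot bit is flipped, back
  -- to zero.
  obtain ⟨T, hT, hTx, hTx'⟩ := exists_toffoli_layer (Q := Qubit (J → Bool) J n K) n
    (fun b : J → Bool => Finset.univ.image fun j => bin j (e b))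
    (fun b => hot b 0) (by simp) (fun i j h => by
      refine Finset.disjoint_left.2 ?_
      simp only [Finset.mem_insert, Finset.mem_image]
      rintro _ (rfl | ⟨a, -, rfl⟩)
      · simp [h]
      · simp [he.eq_iff, h.symm])
  have hR : Circuit.IsClassical (P ++ [N]) := hP.append (.cons hN Circuit.isClassical_nil)
  refine ⟨(P ++ [N]) ++ T :: (P ++ [N]).reverse, hR.append (.cons hT hR.reverse),
    by simp [hPl]; ring, fun b => Circuit.perm_conj ?_⟩
  have hbin : ∀ y : Qubit (J → Bool) J n K → Bool, (∀ j w, y (bin j w) = (b j && decide (w = 0))) →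
      (∀ j w, (Circuit.perm (P ++ [N]) y) (bin j w) = xor (b j) (decide (bin j w ∈
        (Finset.univ.filter fun p : J × (J → Bool) => p.2 p.1 = false).image
          fun p => (bin p.1 (e p.2) : Qubit (J → Bool) J n K)))) ∧
      ∀ q, (∀ j w, q ≠ bin j w) → (Circuit.perm (P ++ [N]) y) q = y q := by
    intro y hy
    obtain ⟨h1, h2⟩ := hPx y (fun c w hw => by rw [hy]; simp [hw])
    refine ⟨fun c w => ?_, fun q hq => ?_⟩
    · rw [Circuit.perm_append, Circuit.perm_cons, Circuit.perm_nil, hNx, h1, hy]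
      simp
    · have : q ∉ (Finset.univ.filter fun p : J × (J → Bool) => p.2 p.1 = false).image
          fun p => (bin p.1 (e p.2) : Qubit (J → Bool) J n K) := fun h => by
        obtain ⟨p, -, rfl⟩ := Finset.mem_image.1 h
        exact hq _ _ rfl
      rw [Circuit.perm_append, Circuit.perm_cons, Circuit.perm_nil, hNx, h2 q hq]
      simp only [this, decide_false, Bool.xor_false]
  obtain ⟨h1, h2⟩ := hbin (fun q => xor (hotString b q) (binString b q)) fun _ _ => by
    simp [hotString, binString]
  obtain ⟨h3, h4⟩ := hbin (binString b) fun _ _ => rfl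
  ext q
  by_cases hq : ∃ c, q = hot c 0
  · obtain ⟨c, rfl⟩ := hq
    rw [hTx, h2 _ (by simp), h4 _ (by simp)]
    have h5 : ∀ j, (bin j (e c) : Qubit (J → Bool) J n K) ∈
        (Finset.univ.filter fun p : J × (J → Bool) => p.2 p.1 = false).image
          (fun p => (bin p.1 (e p.2) : Qubit (J → Bool) J n K)) ↔ c j = false := by
      intro j
      simp only [Finset.mem_image, Finset.mem_filter, Finset.mem_univ, true_and, bin.injEq,
        he.eq_iff, Prod.exists]
      constructor
      · rintro ⟨_, _, h, rfl, rfl⟩; exact h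
      · exact fun h => ⟨j, c, h, rfl, rfl⟩
    have h6 : (∀ q ∈ Finset.univ.image fun j => (bin j (e c) : Qubit (J → Bool) J n K),
        Circuit.perm (P ++ [N]) (fun q => xor (hotString b q) (binString b q)) q = true) ↔
          c = b := by
      simp only [Finset.mem_image, Finset.mem_univ, true_and, forall_exists_index,
        forall_apply_eq_imp_iff, h1, h5]
      rw [funext_iff]
      refine forall_congr' fun j => ?_
      cases b j <;> cases c j <;> simp
    simp only [h6]
    simp [hotString, binString]
  · push Not at hq
    rw [hTx' _ _ hq]
    rcases q with ⟨c, w⟩ | ⟨j, w⟩ | _ | _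
    · have : w ≠ 0 := fun h => hq c (by rw [h])
      rw [h2 _ (by simp), h4 _ (by simp)]; simp [hotString, this]
    · rw [h1, h3]
    · rw [h2 _ (by simp), h4 _ (by simp)]; simp [hotString]
    · rw [h2 _ (by simp), h4 _ (by simp)]; simp [hotString]

/-- Preparation of an arbitrary state in the binary register. -/
lemma exists_binary_circuit (hK : 2 ^ Fintype.card J ≤ (n + 1) ^ K)
    (c : (J → Bool) → ℂ) (hc : ∑ b, ‖c b‖ ^ 2 = 1) :
    ∃ C : Circuit (Qubit (J → Bool) J n K) n, C.length = 6 * K + 19 ∧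
      C.apply (ket fun _ => false) = ∑ b, c b • ket (binString b) := by
  obtain ⟨e⟩ : Nonempty ((J → Bool) ↪ (Fin K → Fin (n + 1))) :=
    Function.Embedding.nonempty_of_card_le (by simpa using hK)
  -- Bits embed into strings as indicators, so the same `K` provides enough copies for both
  -- conversions.
  have hj : Function.Injective fun j : J => e fun i => decide (i = j) := fun i j h => by
    simpa using congrFun (e.injective h) i
  obtain ⟨C₁, hl₁, h₁⟩ := exists_oneHot_circuit (J := J) e.injective c hc
  obtain ⟨C₂, hC₂, hl₂, h₂⟩ := exists_write_binary_circuit hj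
  obtain ⟨C₃, hC₃, hl₃, h₃⟩ := exists_erase_oneHot_circuit e.injective
  refine ⟨C₁ ++ C₂ ++ C₃, by simp only [List.length_append]; omega, ?_⟩
  rw [Circuit.apply_append, Circuit.apply_append, h₁, (Circuit.isLinearMap_apply _).map_sum_smul,
    (Circuit.isLinearMap_apply _).map_sum_smul]
  simp only [hC₂.apply_ket, h₂, hC₃.apply_ket, h₃]

end Qubit

/-! ### Counting ancillae and choosing the constants -/

open Qubit

/-- With `N = (n + 1) ^ K` and `l ≤ 2 ^ l ≤ N`, the number of qubits is at most `2 N² + N + 1 ≤ 4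
N²`. -/
lemma cleanlyPreparable_of_two_pow_le {n K l : ℕ} (h : 2 ^ l ≤ (n + 1) ^ K) {ψ : Vec (Fin l)}
    (hψ : IsState ψ) : CleanlyPreparable n (6 * K + 19) (4 * (n + 1) ^ (2 * K)) ψ := by
  obtain ⟨C, hC, hCψ⟩ := exists_binary_circuit (J := Fin l) (n := n) (K := K) (by simpa using h)
    ψ hψ
  have := CleanlyPreparable.of_sum (fun j : Fin l => (bin j 0 : Qubit (Fin l → Bool) (Fin l) n K))
    (fun a b h => by simpa using h) (s := 4 * (n + 1) ^ (2 * K)) ?_ C hC.le ψ binString ?_ hCψ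
  · rw [eq_sum_smul_ket ψ]
    convert this using 5 with b
    ext j
    simp [binString]
  · rw [Qubit.card, pow_mul']
    simp only [Fintype.card_fun, Fintype.card_bool, Fintype.card_fin]
    have h1 : l ≤ 2 ^ l := Nat.lt_two_pow_self.le
    have h2 : 1 ≤ (n + 1) ^ K := Nat.one_le_pow _ _ (by omega)
    nlinarith
  · intro b q hq
    rcases q with _ | ⟨j, w⟩ | _ | _
    · rfl
    · have : w ≠ 0 := fun h => hq j (by rw [h])
      simp [binString, this]
    all_goals rfl

lemma cleanlyPreparable_oneHot {n : ℕ} {c : Fin n → ℂ} (hc : ∑ i, ‖c i‖ ^ 2 = 1) :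
    CleanlyPreparable n 15 (4 * (n + 1) ^ 2) (∑ i, c i • ket (oneHot i)) := by
  -- One fanout level gives `n + 1` copies, enough for `n` candidates; no binary register is needed.
  obtain ⟨C, hC, hCc⟩ := exists_oneHot_circuit (I := Fin n) (J := Empty) (n := n) (K := 1)
    (e := fun i _ => i.castSucc) (fun i j h => by simpa using congrFun h 0) c hc
  have := CleanlyPreparable.of_sum (fun i : Fin n => (hot i 0 : Qubit (Fin n) Empty n 1))
    (fun a b h => by simpa using h) (s := 4 * (n + 1) ^ 2) ?_ C hC.le c hotString ?_ hCc
  · convert this using 5 with i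
    ext j
    simp [hotString, oneHot]
  · rw [Qubit.card]
    simp only [Fintype.card_fin, Fintype.card_empty]
    nlinarith
  · intro i q hq
    simpa [hotString] using hq i

lemma CleanlyPreparable.mono {k d s s' n : ℕ} {ψ : Vec (Fin n)} (h : CleanlyPreparable k d s ψ)
    (hs : s ≤ s') : CleanlyPreparable k d s' ψ := by
  obtain ⟨m, hm, C⟩ := h
  exact ⟨m, hm.trans hs, C⟩

lemma four_mul_succ_pow_le {n : ℕ} (hn : 2 ≤ n) (a : ℕ) : 4 * (n + 1) ^ a ≤ n ^ (2 * a + 2) := by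
  have h1 : n + 1 ≤ n ^ 2 := by nlinarith
  have h2 : 4 ≤ n ^ 2 := by nlinarith
  calc 4 * (n + 1) ^ a ≤ n ^ 2 * (n ^ 2) ^ a := Nat.mul_le_mul h2 (Nat.pow_le_pow_left h1 a)
    _ = n ^ (2 * a + 2) := by rw [← pow_mul, ← pow_add, add_comm]

/-- Since `2 ≤ e`, `2 ^ l ≤ exp l ≤ n ^ ⌈K⌉₊`. Rounding up in `ℕ` also covers negative `K`. -/
lemma two_pow_le_of_le_mul_log {K : ℝ} {n l : ℕ} (hn : 2 ≤ n) (hl : (l : ℝ) ≤ K * Real.log n) :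
    2 ^ l ≤ (n + 1) ^ ⌈K⌉₊ := by
  have hlog : 0 ≤ Real.log n := Real.log_natCast_nonneg n
  have hn0 : (0 : ℝ) < n := by positivity
  have h1 : (2 : ℝ) ^ l ≤ (n : ℝ) ^ ⌈K⌉₊ := by
    calc (2 : ℝ) ^ l ≤ Real.exp 1 ^ l :=
          pow_le_pow_left₀ (by norm_num) (by linarith [Real.exp_one_gt_d9]) l
      _ = Real.exp l := by rw [← Real.exp_nat_mul, mul_one]
      _ ≤ Real.exp (⌈K⌉₊ * Real.log n) :=
          Real.exp_le_exp.2 (hl.trans (mul_le_mul_of_nonneg_right (Nat.le_ceil K) hlog))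
      _ = (n : ℝ) ^ ⌈K⌉₊ := by rw [Real.exp_nat_mul, Real.exp_log hn0]
  have h2 : 2 ^ l ≤ n ^ ⌈K⌉₊ := by exact_mod_cast h1
  exact h2.trans (Nat.pow_le_pow_left n.le_succ _)

end QAC

end

theorem mainTheorem6 :
    (∀ K : ℝ, ∃ d a n₀ : ℕ, ∀ n ≥ n₀, ∀ l : ℕ, (l : ℝ) ≤ K * Real.log n →
      ∀ ψ : QAC.Vec (Fin l), QAC.IsState ψ → QAC.CleanlyPreparable n d (n ^ a) ψ) ∧
    (∃ d a n₀ : ℕ, ∀ n ≥ n₀, ∀ c : Fin n → ℂ, ∑ i, ‖c i‖ ^ 2 = 1 →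
      QAC.CleanlyPreparable n d (n ^ a) (∑ i, c i • QAC.ket (QAC.oneHot i))) := by
  constructor
  · intro K
    refine ⟨6 * ⌈K⌉₊ + 19, 2 * (2 * ⌈K⌉₊) + 2, 2, fun n hn l hl ψ hψ => ?_⟩
    exact (QAC.cleanlyPreparable_of_two_pow_le (QAC.two_pow_le_of_le_mul_log hn hl) hψ).mono
      (QAC.four_mul_succ_pow_le hn _)
  · exact ⟨15, 2 * 2 + 2, 2, fun n hn c hc =>
      (QAC.cleanlyPreparable_oneHot hc).mono (QAC.four_mul_succ_pow_le hn _)⟩
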